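/- Let $X$ be a real locally convex Hausdorff topological vector space, $T$ a nonempty (typically infinite) index set, and let $f$ and $f_t$ ($t\in T$) be proper, convex, lower semicontinuous functions $X\to\mathbb{R}\cup\{+\infty\}$. Consider the problem $$(\mathrm{P})\qquad \inf f(x)\quad\text{s.t.}\quad f_t(x)\le 0,\ t\in T,$$ with feasible set $E=\{x\in X: f_t(x)\le 0\ \ \forall t\in T\}$. Let $\mathbb{R}_+^{(T)}$ be the set of functions $\lambda:T\to[0,+\infty)$ with finite support; $\sum_{t\in T}\lambda_t f_t$ denotes the sum over the support of $\lambda$ (zero if the support is empty), and $0\times(+\infty)=0$. The Lagrangian-Haar dual of $(\mathrm{P})$ has the value $$\sup(\mathrm{D})=\sup_{\emptyset\ne H\subset T\text{ finite},\ \mu\in\mathbb{R}_+^H}\ \inf_{x\in X}\Big\{f(x)+\sum_{t\in H}\mu_t f_t(x)\Big\}.$$ For a proper convex lower semicontinuous function $h$, the recession function $h_\infty$ is the function whose epigraph is the recession cone of the epigraph of $h$, and $h$ is called weakly inf-locally compact if for every $r\in\mathbb{R}$ the sublevel set $\{x\in X:h(x)\le r\}$ is locally compact in the weak topology of $X$.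 Put $$(\mathrm{P})_\infty=\bigcap_{t\in T}\{x\in X:(f_t)_\infty(x)\le 0\}\cap\{x\in X:f_\infty(x)\le 0\}.$$ Assume that $E\cap\operatorname{dom}f\ne\emptyset$, that there exists $\lambda\in\mathbb{R}_+^{(T)}$ such that $f+\sum_{t\in T}\lambda_t f_t$ is weakly inf-locally compact, and that $(\mathrm{P})_\infty$ is a linear subspace of $X$. Then $(\mathrm{P})$ attains its infimum, and $$\min(\mathrm{P})=\sup(\mathrm{D})=\sup_{\lambda\in\mathbb{R}_+^{(T)}}\ \inf_{x\in X}\Big\{f(x)+\sum_{t\in T}\lambda_t f_t(x)\Big\}\in\mathbb{R}.$$ -/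

import Mathlib

open scoped NNReal

/-- The epigraph of an extended-real-valued function, as a subset of `X × ℝ`. -/
def epi {X : Type*} (h : X → EReal) : Set (X × ℝ) :=
  {p | h p.1 ≤ (p.2 : EReal)}

/-- The effective domain `dom h` of an extended-real-valued function. -/
def effDom {X : Type*} (h : X → EReal) : Set X :=
  {x | h x < ⊤}

/-- The class `Γ(X)` of proper, convex, lower semicontinuous functions `X → ℝ ∪ {±∞}`. -/
structure IsGamma {X : Type*} [AddCommGroup X] [Module ℝ X] [TopologicalSpace X]
    (h : X → EReal) : Prop where
  epi_nonempty : (epi h).Nonempty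
  ne_bot : ∀ x, h x ≠ ⊥
  convex : Convex ℝ (epi h)
  isClosed : IsClosed (epi h)

/-- The recession cone `A_∞` of a (convex) set `A`. -/
def recCone {V : Type*} [AddCommGroup V] [Module ℝ V] (A : Set V) : Set V :=
  {d | ∀ a ∈ A, ∀ s : ℝ, 0 ≤ s → a + s • d ∈ A}

/-- The recession function `h_∞` of `h`: the function whose epigraph is the recession cone
of the epigraph of `h` (see `epi_recFun`). -/
noncomputable def recFun {X : Type*} [AddCommGroup X] [Module ℝ X] (h : X → EReal) :
    X → EReal :=
  fun x => ⨅ (r : ℝ) (_ : (x, r) ∈ recCone (epi h)), (r : EReal)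

/-- For `h` in `Γ(X)`, the recession function satisfies `epi h_∞ = (epi h)_∞`. -/
theorem epi_recFun {X : Type*} [AddCommGroup X] [Module ℝ X] [TopologicalSpace X]
    [IsTopologicalAddGroup X] [ContinuousSMul ℝ X] {h : X → EReal} (hh : IsGamma h) :
    epi (recFun h) = recCone (epi h) := by
  ext ⟨x, r⟩
  constructor
  · intro hx a ha s hs
    have key : ∀ ε : ℝ, 0 < ε → a + s • (x, r + ε) ∈ epi h := by
      intro ε hε
      have h1 : recFun h x < ((r + ε : ℝ) : EReal) :=
        lt_of_le_of_lt hx (by exact_mod_cast lt_add_of_pos_right r hε)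
      simp only [recFun, iInf_lt_iff] at h1
      obtain ⟨q, hq, hqr⟩ := h1
      have hqr' : q < r + ε := by exact_mod_cast hqr
      have h2 := hq a ha s hs
      simp only [epi, Set.mem_ofPred_eq, Prod.fst_add, Prod.smul_fst, Prod.snd_add,
        Prod.smul_snd, smul_eq_mul] at h2 ⊢
      refine h2.trans ?_
      have : a.2 + s * q ≤ a.2 + s * (r + ε) := by
        have := mul_le_mul_of_nonneg_left hqr'.le hs
        linarith
      exact_mod_cast this
    have hcont : Continuous fun ε : ℝ => a + s • (x, r + ε) := by fun_prop
    have hlim : Filter.Tendsto (fun ε : ℝ => a + s • (x, r + ε)) (nhdsWithin 0 (Set.Ioi 0))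
        (nhds (a + s • (x, r))) := by
      have := hcont.tendsto 0
      simp only [add_zero] at this
      exact this.mono_left nhdsWithin_le_nhds
    exact hh.isClosed.mem_of_tendsto hlim
      (Filter.eventually_of_mem self_mem_nhdsWithin fun ε hε => key ε hε)
  · intro hx
    exact iInf₂_le (f := fun (q : ℝ) (_ : (x, q) ∈ recCone (epi h)) => (q : EReal)) r hx

/-- `h` is weakly inf-locally compact: every sublevel set `[h ≤ r]`, `r ∈ ℝ`, is locally compact
for the weak topology of `X`. -/
def WeaklyInfLocallyCompact {X : Type*} [AddCommGroup X] [Module ℝ X] [TopologicalSpace X]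
    [IsTopologicalAddGroup X] [ContinuousSMul ℝ X] (h : X → EReal) : Prop :=
  ∀ r : ℝ, LocallyCompactSpace (toWeakSpace ℝ X '' {x : X | h x ≤ (r : EReal)})

/-- The feasible set `E` of the problem `inf f(x)` subject to `f_t(x) ≤ 0`, `t ∈ T`. -/
def feasibleSet {X T : Type*} (ft : T → X → EReal) : Set X :=
  {x | ∀ t, ft t x ≤ 0}

/-- The recession cone `(P)_∞` of the problem. -/
noncomputable def problemRecCone {X T : Type*} [AddCommGroup X] [Module ℝ X]
    (f : X → EReal) (ft : T → X → EReal) : Set X :=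
  (⋂ t, {x | recFun (ft t) x ≤ 0}) ∩ {x | recFun f x ≤ 0}

/-- The Lagrangian `f(x) + ∑_{t ∈ T} λ_t f_t(x)` for a multiplier `λ ≥ 0` of finite support.
In `EReal`, `0 * ⊤ = 0`. -/
noncomputable def lagrangian {X T : Type*} (f : X → EReal) (ft : T → X → EReal)
    (lam : T →₀ ℝ≥0) (x : X) : EReal :=
  f x + ∑ t ∈ lam.support, ((lam t : ℝ) : EReal) * ft t x

/-- `sup_λ inf_x {f(x) + ∑_{t ∈ T} λ_t f_t(x)}` over the nonnegative `λ` of finite support. -/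
noncomputable def supLagrangeDual {X T : Type*} (f : X → EReal) (ft : T → X → EReal) : EReal :=
  ⨆ lam : T →₀ ℝ≥0, ⨅ x : X, lagrangian f ft lam x

/-- `sup (D)`: the supremum, over the nonempty finite sets `H ⊆ T` and the `μ ∈ ℝ₊^H`, of
`inf_x {f(x) + ∑_{t ∈ H} μ_t f_t(x)}`. -/
noncomputable def supLagrangeHaarDual {X T : Type*} (f : X → EReal) (ft : T → X → EReal) :
    EReal :=
  ⨆ (H : Finset T) (_ : H.Nonempty) (μ : H → ℝ≥0),
    ⨅ x : X, (f x + ∑ t : H, ((μ t : ℝ) : EReal) * ft t x)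

/-! Weak duality is immediate; the content is attainment and the reverse inequality, and both come
from weak compactness modulo the recession space `L`. Moving along `L` increases neither `f` nor any
`f_t`, so every point may be translated by `L` into a chosen slice. Local weak compactness of one
Lagrangian sublevel set near a feasible point gives a weakly compact piece of a finite subsystem. A
sequence of escaping directions in the slice would produce a recession direction outside `L`, so
finitely many constraints already make the whole slice weakly compact
(`exists_isCompact_inter_slice`, `exists_isCompact_weak_slice`). Weierstrass on this slice yields a
minimizer.

If `α` is below the optimal value, the system `f ≤ α`, `f_t ≤ 0` has no solution. By compactness
neither has some finite system `f ≤ α`, `f_t ≤ 1/(n+1)`. The relaxation turns the feasible point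
into a Slater point, so finite-dimensional separation gives multipliers (`exists_multipliers`).
Since `0 * ⊤ = 0`, a vanishing multiplier would discard the domain of its constraint;
`exists_pos_multipliers` therefore makes all of them positive at an arbitrarily small loss. -/

/-! ### Compactness modulo recession directions -/

/-- Let `S i` be closed convex sets through `x₀` whose common recession directions at `x₀` form a
subspace `L`. If finitely many of the `S i` have a relatively compact intersection with a slab
`‖φ (x - x₀)‖ ≤ 1`, then finitely many of them have a compact intersection with an affine subspace
through `x₀` that is complementary to `L`. -/
theorem exists_isCompact_inter_slice {Y E ι : Type*} [AddCommGroup Y] [Module ℝ Y]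
    [TopologicalSpace Y] [IsTopologicalAddGroup Y] [ContinuousSMul ℝ Y]
    [NormedAddCommGroup E] [NormedSpace ℝ E] [FiniteDimensional ℝ E]
    (S : ι → Set Y) (hcl : ∀ i, IsClosed (S i)) (hcv : ∀ i, Convex ℝ (S i))
    (x₀ : Y) (hx₀ : ∀ i, x₀ ∈ S i) (L : Submodule ℝ Y)
    (hL : ∀ d, (∀ i, ∀ s : ℝ, 0 ≤ s → x₀ + s • d ∈ S i) → d ∈ L)
    (F : Finset ι) (K : Set Y) (hK : IsCompact K) (φ : Y →L[ℝ] E)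
    (hφ : ∀ x, (∀ i ∈ F, x ∈ S i) → ‖φ (x - x₀)‖ ≤ 1 → x ∈ K) :
    ∃ (H : Finset ι) (M : Submodule ℝ Y), (∀ x, ∃ l ∈ L, x + l - x₀ ∈ M) ∧
      IsCompact {x | (∀ i ∈ H, x ∈ S i) ∧ x - x₀ ∈ M} := by
  classical
  -- The complement is taken in the finite-dimensional image, so `M` is closed without any
  -- assumption on `L`.
  obtain ⟨W, hW⟩ := Submodule.exists_isCompl (L.map (φ : Y →ₗ[ℝ] E))
  set M : Submodule ℝ Y := W.comap (φ : Y →ₗ[ℝ] E) with hM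
  have hMcl : IsClosed {x : Y | x - x₀ ∈ M} := by
    have : IsClosed (W : Set E) := W.closed_of_finiteDimensional
    exact this.preimage (f := fun x : Y => φ (x - x₀)) (by fun_prop)
  have hScl : ∀ H : Finset ι, IsClosed {x : Y | ∀ i ∈ H, x ∈ S i} := fun H => by
    simp only [Set.ofPred_forall]
    exact isClosed_biInter fun i _ => hcl i
  set P : Set Y := K ∩ ({x | ∀ i ∈ F, x ∈ S i} ∩ {x | x - x₀ ∈ M} ∩ {x | ‖φ (x - x₀)‖ = 1})
    with hP
  have hPc : IsCompact P := by
    refine hK.inter_right (((hScl F).inter hMcl).inter ?_)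
    exact isClosed_eq (by fun_prop) continuous_const
  -- `Z (H, n)` holds the points whose ray from `x₀` stays in the sets of `H` up to time `n`. A
  -- point of `P` in all of them would give a direction in `L` with image in `φ(L) ∩ W = 0`,
  -- although its norm is 1.
  let Z : Finset ι × ℕ → Set Y := fun p =>
    {x | ∀ i ∈ p.1, ∀ s : ℝ, 0 ≤ s → s ≤ p.2 → x₀ + s • (x - x₀) ∈ S i}
  have hZcl : ∀ p, IsClosed (Z p) := fun p => by
    simp only [Z, Set.ofPred_forall]
    refine isClosed_biInter fun i _ => isClosed_iInter fun s => isClosed_iInter fun _ =>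
      isClosed_iInter fun _ => (hcl i).preimage (by fun_prop)
  have hempty : P ∩ ⋂ p, Z p = ∅ := by
    rw [Set.eq_empty_iff_forall_notMem]
    rintro x ⟨⟨-, ⟨-, hxM⟩, hx1⟩, hx⟩
    have hxL : x - x₀ ∈ L := hL _ fun i s hs => by
      obtain ⟨n, hn⟩ := exists_nat_ge s
      exact Set.mem_iInter.1 hx ({i}, n) i (Finset.mem_singleton_self i) s hs hn
    have h0 : φ (x - x₀) = 0 :=
      (Submodule.disjoint_def.1 hW.disjoint) _ (Submodule.mem_map_of_mem hxL) hxM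
    simp only [Set.mem_ofPred_eq, h0, norm_zero] at hx1
    exact zero_ne_one hx1
  have hdir : Directed (· ⊇ ·) Z := by
    rintro ⟨H, n⟩ ⟨H', n'⟩
    refine ⟨(H ∪ H', max n n'), fun x hx i hi s hs hsn => ?_, fun x hx i hi s hs hsn => ?_⟩
    · exact hx i (Finset.mem_union_left _ hi) s hs (hsn.trans (by exact_mod_cast le_max_left _ _))
    · exact hx i (Finset.mem_union_right _ hi) s hs (hsn.trans (by exact_mod_cast le_max_right _ _))
  obtain ⟨⟨H, n⟩, hHn⟩ := hPc.elim_directed_family_closed Z hZcl hempty hdir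
  have hseg : ∀ i, ∀ x ∈ S i, ∀ s : ℝ, 0 ≤ s → s ≤ 1 → x₀ + s • (x - x₀) ∈ S i :=
    fun i x hx s hs hs1 => (hcv i).add_smul_sub_mem (hx₀ i) hx ⟨hs, hs1⟩
  refine ⟨H ∪ F, M, fun x => ?_, ?_⟩
  · have : φ (x₀ - x) ∈ L.map (φ : Y →ₗ[ℝ] E) ⊔ W := by rw [hW.sup_eq_top]; trivial
    obtain ⟨_, ⟨l, hl, rfl⟩, w, hw, hlw⟩ := Submodule.mem_sup.1 this
    refine ⟨l, hl, ?_⟩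
    have : φ (x + l - x₀) = -w := by
      have h2 : φ l + w = φ x₀ - φ x := by simpa using hlw
      rw [map_sub, map_add, eq_neg_iff_add_eq_zero, sub_add_eq_add_sub, add_assoc, h2]
      abel
    simpa [hM, this] using hw
  · set R : ℝ := max n 1 with hR
    have hR1 : 1 ≤ R := le_max_right _ _
    have hR0 : 0 < R := by linarith
    -- A point beyond radius `R` could be contracted by convexity onto the unit sphere of `φ`,
    -- landing in the empty set `P ∩ Z (H, n)`.
    have hbound : ∀ x, (∀ i ∈ H ∪ F, x ∈ S i) → x - x₀ ∈ M → ‖φ (x - x₀)‖ ≤ R := by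
      intro x hx hxM
      by_contra! hlt
      set r := ‖φ (x - x₀)‖ with hr
      have hr0 : 0 < r := hR0.trans hlt
      have hz : x₀ + r⁻¹ • (x - x₀) ∈ P ∩ Z (H, n) := by
        have hzF : ∀ i ∈ F, x₀ + r⁻¹ • (x - x₀) ∈ S i := fun i hi =>
          hseg i x (hx i (Finset.mem_union_right _ hi)) _ (by positivity)
            (inv_le_one_of_one_le₀ (hR1.trans hlt.le))
        have hz1 : ‖φ (x₀ + r⁻¹ • (x - x₀) - x₀)‖ = 1 := by
          rw [add_sub_cancel_left, map_smul, norm_smul, Real.norm_of_nonneg (by positivity), ← hr,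
            inv_mul_cancel₀ hr0.ne']
        refine ⟨⟨hφ _ hzF hz1.le, ⟨hzF, ?_⟩, hz1⟩, fun i hi s hs hsn => ?_⟩
        · simpa using M.smul_mem r⁻¹ hxM
        · have : s ≤ r := hsn.trans ((le_max_left _ _).trans hlt.le)
          rw [add_sub_cancel_left, smul_smul]
          exact hseg i x (hx i (Finset.mem_union_left _ hi)) _ (by positivity)
            (by rw [← div_eq_mul_inv, div_le_one hr0]; exact this)
      rw [hHn] at hz
      exact hz
    -- Contraction by `R⁻¹` puts the slice inside `K`, so the slice lies in the `R`-dilate of `K`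
    -- about `x₀`.
    refine (hK.image (f := fun y => x₀ + R • (y - x₀)) (by fun_prop)).of_isClosed_subset
      ((hScl _).inter hMcl) ?_
    rintro x ⟨hx, hxM⟩
    refine ⟨x₀ + R⁻¹ • (x - x₀), hφ _ (fun i hi => ?_) ?_, ?_⟩
    · exact hseg i x (hx i (Finset.mem_union_right _ hi)) _ (by positivity)
        (inv_le_one_of_one_le₀ hR1)
    · rw [add_sub_cancel_left, map_smul, norm_smul, Real.norm_of_nonneg (by positivity),
        inv_mul_le_one₀ hR0]
      exact hbound x hx hxM
    · simp [smul_smul, hR0.ne']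

/-- Every weak neighbourhood contains a slab `‖φ (y - x₀)‖ ≤ 1` with `φ` of finite rank. -/
theorem WeakSpace.exists_slab_subset {X : Type*} [AddCommGroup X] [Module ℝ X]
    [TopologicalSpace X] [IsTopologicalAddGroup X] [ContinuousSMul ℝ X]
    (x₀ : WeakSpace ℝ X) (U : Set (WeakSpace ℝ X)) (hU : U ∈ nhds x₀) :
    ∃ (s : Finset (StrongDual ℝ X)) (φ : WeakSpace ℝ X →L[ℝ] (s → ℝ)),
      ∀ y, ‖φ (y - x₀)‖ ≤ 1 → y ∈ U := by
  have hb := (topDualPairing ℝ X).flip.hasBasis_weakBilin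
  have hU0 : (fun y : WeakSpace ℝ X => x₀ + y) ⁻¹' U ∈ nhds (0 : WeakSpace ℝ X) :=
    (Continuous.tendsto' (by fun_prop) _ _ (add_zero x₀)) hU
  obtain ⟨V, hV, hVU⟩ := hb.mem_iff.1 hU0
  obtain ⟨s, r, hr, rfl⟩ := (SeminormFamily.basisSets_iff _).1 hV
  let ψ : StrongDual ℝ X → (WeakSpace ℝ X →L[ℝ] ℝ) := fun f =>
    { toLinearMap := (f : X →ₗ[ℝ] ℝ) ∘ₗ (toWeakSpace ℝ X).symm.toLinearMap
      cont := WeakBilin.eval_continuous (topDualPairing ℝ X).flip f }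
  -- The factor 2 turns the closed condition `≤ 1` into the strict bound `< r` of the open seminorm
  -- ball.
  refine ⟨s, (2 / r) • ContinuousLinearMap.pi fun f : s => ψ f, fun y hy => ?_⟩
  have : (toWeakSpace ℝ X).symm (y - x₀) ∈
      (s.sup (topDualPairing ℝ X).flip.toSeminormFamily).ball 0 r := by
    refine (Seminorm.mem_ball_zero _).2 ?_
    refine Seminorm.finset_sup_apply_lt hr fun f hf => ?_
    have h1 := (norm_le_pi_norm _ (⟨f, hf⟩ : s)).trans hy
    have h2 : ‖(2 / r) * ψ f (y - x₀)‖ ≤ 1 := h1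
    have h3 : ‖ψ f (y - x₀)‖ < r := by
      rw [norm_mul, Real.norm_of_nonneg (by positivity), div_mul_eq_mul_div, div_le_one hr] at h2
      nlinarith [norm_nonneg (ψ f (y - x₀))]
    exact h3
  have h4 : x₀ + (y - x₀) ∈ U := hVU this
  rwa [add_sub_cancel] at h4

/-! ### Multipliers by finite-dimensional separation -/

/-- Multiplier rule for a convex system without solution: if `g j x ≤ c j` (all `j`) has no
solution, while all inequalities but that of index `i₀` can be satisfied strictly, then there are
multipliers with `lam i₀ = 1`. -/
theorem exists_multipliers {X ι : Type*} [AddCommGroup X] [Module ℝ X] [Fintype ι]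
    (g : ι → X → EReal) (hg : ∀ j, Convex ℝ (epi (g j))) (c : ι → ℝ) (i₀ : ι)
    (x₀ : X) (hx₀ : ∀ j, j ≠ i₀ → g j x₀ < c j) (hi₀ : g i₀ x₀ < ⊤)
    (hno : ∀ x, ¬ ∀ j, g j x ≤ c j) :
    ∃ lam : ι → ℝ, (∀ j, 0 ≤ lam j) ∧ lam i₀ = 1 ∧
      ∀ x, ∀ y : ι → ℝ, (∀ j, g j x ≤ y j) → ∑ j, lam j * c j ≤ ∑ j, lam j * y j := by
  classical
  let A : Set (ι → ℝ) := {y | ∃ x, ∀ j, g j x ≤ y j}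
  let B : Set (ι → ℝ) := Set.univ.pi fun j => Set.Iio (c j)
  have hA : Convex ℝ A := by
    rintro y ⟨x, hx⟩ y' ⟨x', hx'⟩ a b ha hb hab
    exact ⟨a • x + b • x', fun j => hg j (x := (x, y j)) (hx j) (y := (x', y' j)) (hx' j) ha hb hab⟩
  have hB : Convex ℝ B := convex_pi fun j _ => convex_Iio (c j)
  have hBo : IsOpen B := isOpen_set_pi Set.finite_univ fun j _ => isOpen_Iio
  have hdisj : Disjoint B A := by
    rw [Set.disjoint_left]
    rintro y hy ⟨x, hx⟩
    exact hno x fun j => (hx j).trans (by exact_mod_cast (hy j trivial).le)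
  obtain ⟨φ, u, hφB, hφA⟩ := geometric_hahn_banach_open hB hBo hA hdisj
  set w : ι → ℝ := fun j => φ (Pi.single j 1) with hw
  have hφ : ∀ y, φ y = ∑ j, w j * y j := fun y => by
    conv_lhs => rw [pi_eq_sum_univ' y, map_sum]
    refine Finset.sum_congr rfl fun j _ => ?_
    rw [map_smul, smul_eq_mul, mul_comm]
  obtain ⟨y₀, hy₀, hy₀c⟩ : ∃ y₀ : ι → ℝ, (∀ j, g j x₀ ≤ y₀ j) ∧ ∀ j, j ≠ i₀ → y₀ j < c j := by
    have : ∀ j, ∃ r : ℝ, g j x₀ ≤ r ∧ (j ≠ i₀ → r < c j) := fun j => by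
      by_cases hj : j = i₀
      · obtain ⟨r, hr, -⟩ := EReal.lt_iff_exists_real_btwn.1 hi₀
        exact ⟨r, hj ▸ hr.le, fun h => (h hj).elim⟩
      · obtain ⟨r, hr, hr'⟩ := EReal.lt_iff_exists_real_btwn.1 (hx₀ j hj)
        exact ⟨r, hr.le, fun _ => by exact_mod_cast hr'⟩
    choose y₀ h1 h2 using this
    exact ⟨y₀, h1, h2⟩
  -- `A` is stable under increasing coordinates, so a negative weight would make `φ` unbounded below
  -- on it.
  have hw0 : ∀ j, 0 ≤ w j := fun j => by
    by_contra! hneg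
    obtain ⟨n, hn⟩ := exists_nat_gt ((φ y₀ - u) / -w j)
    have hmem : y₀ + (n : ℝ) • (Pi.single j 1 : ι → ℝ) ∈ A := by
      refine ⟨x₀, fun k => (hy₀ k).trans ?_⟩
      have : (0 : ℝ) ≤ n * (Pi.single j 1 : ι → ℝ) k := by
        rw [Pi.single_apply]; split_ifs <;> simp
      exact_mod_cast (by simpa using this : y₀ k ≤ (y₀ + (n : ℝ) • (Pi.single j 1 : ι → ℝ)) k)
    have := hφA _ hmem
    rw [map_add, map_smul, smul_eq_mul] at this
    rw [div_lt_iff₀ (by linarith)] at hn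
    change u ≤ φ y₀ + n * w j at this
    linarith
  have hcu : ∀ y ∈ A, ∑ j, w j * c j ≤ ∑ j, w j * y j := fun y hy => by
    rw [← hφ, ← hφ]
    refine le_trans ?_ (hφA y hy)
    have hlim : Filter.Tendsto (fun e : ℝ => φ (fun j => c j - e)) (nhdsWithin 0 (Set.Ioi 0))
        (nhds (φ c)) := by
      have : Continuous fun e : ℝ => φ (fun j => c j - e) :=
        φ.continuous.comp (by fun_prop)
      have := this.tendsto 0
      simp only [sub_zero] at this
      exact this.mono_left nhdsWithin_le_nhds
    refine le_of_tendsto hlim (Filter.eventually_of_mem self_mem_nhdsWithin fun e he => ?_)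
    exact (hφB _ fun j _ => by simpa using he).le
  -- Slater argument: if `w i₀ = 0`, strictness at `x₀` forces every other weight to vanish, which
  -- contradicts strict separation.
  have hpos : 0 < w i₀ := by
    refine (hw0 i₀).lt_of_ne fun h0 => ?_
    have h1 := hcu y₀ ⟨x₀, hy₀⟩
    have h2 : ∀ j ∈ Finset.univ, w j * y₀ j ≤ w j * c j := fun j _ => by
      by_cases hj : j = i₀
      · simp [hj, ← h0]
      · exact mul_le_mul_of_nonneg_left (hy₀c j hj).le (hw0 j)
    have h3 := (Finset.sum_eq_sum_iff_of_le h2).1 (le_antisymm (Finset.sum_le_sum h2) h1)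
    have h4 : ∀ j, w j = 0 := fun j => by
      by_cases hj : j = i₀
      · rw [hj, ← h0]
      · have := h3 j (Finset.mem_univ j)
        by_contra hne
        exact (hy₀c j hj).ne (mul_left_cancel₀ hne this)
    have h5 := hφB (fun j => c j - 1) fun j _ => by simp
    have h6 := hφA y₀ ⟨x₀, hy₀⟩
    simp only [hφ, h4, zero_mul, Finset.sum_const_zero] at h5 h6
    linarith
  refine ⟨fun j => (w i₀)⁻¹ * w j, fun j => mul_nonneg (by positivity) (hw0 j),
    inv_mul_cancel₀ hpos.ne', fun x y hxy => ?_⟩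
  simp only [mul_assoc, ← Finset.mul_sum]
  exact mul_le_mul_of_nonneg_left (hcu y ⟨x, hxy⟩) (by positivity)

/-- Strictly positive multipliers: the system `g j x ≤ c j` without solution yields multipliers that
can be perturbed to be positive when each `g i` is bounded below on a set `g j x ≤ b j`
around `x₀`. -/
theorem exists_pos_multipliers {X ι : Type*} [AddCommGroup X] [Module ℝ X] [Fintype ι]
    (g : ι → X → EReal) (hg : ∀ j, Convex ℝ (epi (g j))) (b c : ι → ℝ) (i₀ : ι)
    (x₀ : X) (hx₀ : ∀ j, j ≠ i₀ → g j x₀ < c j) (hb : ∀ j, g j x₀ < b j)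
    (hno : ∀ x, ¬ ∀ j, g j x ≤ c j)
    (hbdd : ∀ i, ∃ N : ℝ, ∀ x, (∀ j, g j x ≤ b j) → N < g i x)
    (hc : ∀ j, j ≠ i₀ → 0 ≤ c j) (α : ℝ) (hα : α < c i₀) :
    ∃ lam : ι → ℝ, (∀ j, 0 < lam j) ∧ lam i₀ = 1 ∧
      ∀ x, ∀ y : ι → ℝ, (∀ j, g j x ≤ y j) → α ≤ ∑ j, lam j * y j := by
  classical
  obtain ⟨l₀, hl₀, hl₀1, hl₀y⟩ := exists_multipliers g hg c i₀ x₀ hx₀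
    ((hb i₀).trans (EReal.coe_lt_top _)) hno
  have hi : ∀ i, ∃ (l : ι → ℝ) (B : ℝ), (∀ j, 0 ≤ l j) ∧ l i = 1 ∧
      ∀ x, ∀ y : ι → ℝ, (∀ j, g j x ≤ y j) → B ≤ ∑ j, l j * y j := fun i => by
    obtain ⟨N, hN⟩ := hbdd i
    -- Pushing the level of `g i` below its lower bound makes the system infeasible. The minimum
    -- with `b i` keeps its solutions inside the set where that bound is valid.
    obtain ⟨l, h0, h1, h2⟩ := exists_multipliers g hg (Function.update b i (min N (b i))) i x₀
      (fun j hj => by rw [Function.update_of_ne hj]; exact hb j)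
      ((hb i).trans (EReal.coe_lt_top _)) fun x hx => by
        have h3 : g i x ≤ (min N (b i) : ℝ) := by simpa using hx i
        refine (hN x fun j => ?_).not_ge (h3.trans (by exact_mod_cast min_le_left _ _))
        by_cases hj : j = i
        · exact hj ▸ h3.trans (by exact_mod_cast min_le_right _ _)
        · simpa [Function.update_of_ne hj] using hx j
    exact ⟨l, _, h0, h1, h2⟩
  choose l B hl hl1 hly using hi
  set s : ι → ℝ := fun j => ∑ i, l i j with hs
  have hs1 : ∀ j, 1 ≤ s j := fun j => by
    rw [← hl1 j]
    exact Finset.single_le_sum (f := fun i => l i j) (fun i _ => hl i j) (Finset.mem_univ j)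
  set D : ℝ := ∑ i, B i with hD
  have hsy : ∀ x, ∀ y : ι → ℝ, (∀ j, g j x ≤ y j) → D ≤ ∑ j, s j * y j := fun x y hxy => by
    simp only [hs, Finset.sum_mul]
    rw [Finset.sum_comm]
    exact Finset.sum_le_sum fun i _ => hly i x y hxy
  -- The final weights are `l₀ + δ s`, normalized at `i₀`; `δ` is small enough for the perturbation
  -- to cost at most the gap `c i₀ - α`.
  obtain ⟨δ, hδ, hδα⟩ : ∃ δ : ℝ, 0 < δ ∧ α * (1 + δ * s i₀) ≤ c i₀ + δ * D := by
    set q := |D - α * s i₀| + 1 with hq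
    have hq0 : 0 < q := by positivity
    refine ⟨(c i₀ - α) / q, div_pos (by linarith) hq0, ?_⟩
    have h1 : (c i₀ - α) / q * q = c i₀ - α := div_mul_cancel₀ _ hq0.ne'
    have h2 : 0 ≤ (c i₀ - α) / q := (div_pos (by linarith) hq0).le
    have h3 : -q ≤ D - α * s i₀ := by linarith [neg_abs_le (D - α * s i₀)]
    nlinarith [mul_le_mul_of_nonneg_left h3 h2]
  have hden : 0 < 1 + δ * s i₀ := by nlinarith [hs1 i₀]
  refine ⟨fun j => (1 + δ * s i₀)⁻¹ * (l₀ j + δ * s j), fun j => ?_, ?_, fun x y hxy => ?_⟩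
  · have : 0 < δ * s j := mul_pos hδ (by linarith [hs1 j])
    have := hl₀ j
    positivity
  · simp only [hl₀1]; exact inv_mul_cancel₀ hden.ne'
  · have h1 := hl₀y x y hxy
    have h2 := hsy x y hxy
    have h3 : c i₀ ≤ ∑ j, l₀ j * c j := by
      rw [← Finset.add_sum_erase _ _ (Finset.mem_univ i₀), hl₀1, one_mul, le_add_iff_nonneg_right]
      exact Finset.sum_nonneg fun j hj => mul_nonneg (hl₀ j) (hc j (Finset.ne_of_mem_erase hj))
    simp only [mul_assoc, ← Finset.mul_sum, add_mul, Finset.sum_add_distrib]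
    rw [inv_mul_eq_div, le_div_iff₀ hden]
    have := mul_le_mul_of_nonneg_left h2 hδ.le
    linarith

/-! ### Weak topology and recession functions -/

section Gamma

variable {X : Type*} [AddCommGroup X] [Module ℝ X] [TopologicalSpace X] {h : X → EReal}

theorem IsGamma.convex_sublevel (hh : IsGamma h) (a : ℝ) : Convex ℝ {x | h x ≤ a} := by
  intro x hx y hy s t hs ht hst
  have := hh.convex (x := (x, a)) hx (y := (y, a)) hy hs ht hst
  simpa [epi, ← add_mul, hst] using this

theorem IsGamma.isClosed_sublevel (hh : IsGamma h) (a : ℝ) : IsClosed {x | h x ≤ a} :=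
  hh.isClosed.preimage (f := fun x : X => (x, a)) (by fun_prop)

variable [IsTopologicalAddGroup X] [ContinuousSMul ℝ X]

/-- Mazur's theorem: in a locally convex space, closed convex sets are weakly closed. -/
theorem IsGamma.isClosed_weak_sublevel [LocallyConvexSpace ℝ X] (hh : IsGamma h) (a : ℝ) :
    IsClosed {y : WeakSpace ℝ X | h ((toWeakSpace ℝ X).symm y) ≤ a} := by
  have h1 := (hh.convex_sublevel a).toWeakSpace_closure ℝ
  rw [(hh.isClosed_sublevel a).closure_eq] at h1
  have h2 : {y : WeakSpace ℝ X | h ((toWeakSpace ℝ X).symm y) ≤ a} =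
      toWeakSpace ℝ X '' {x | h x ≤ a} := by
    rw [LinearEquiv.image_eq_preimage_symm]; rfl
  rw [h2, h1]
  exact isClosed_closure

theorem IsGamma.lowerSemicontinuous_weak [LocallyConvexSpace ℝ X] (hh : IsGamma h) :
    LowerSemicontinuous fun y : WeakSpace ℝ X => h ((toWeakSpace ℝ X).symm y) := by
  rw [lowerSemicontinuous_iff_isClosed_preimage]
  intro a
  induction a with
  | bot =>
    convert isClosed_empty
    ext y
    simpa using hh.ne_bot _
  | coe a => exact hh.isClosed_weak_sublevel a
  | top => simp

theorem IsGamma.recFun_nonpos_iff (hh : IsGamma h) (d : X) :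
    recFun h d ≤ 0 ↔ (d, (0 : ℝ)) ∈ recCone (epi h) := by
  rw [← epi_recFun hh]; simp [epi]

/-- A direction along which `h` decreases weakly from every point. -/
theorem IsGamma.le_of_recFun_nonpos (hh : IsGamma h) {d : X} (hd : recFun h d ≤ 0) (x : X)
    {s : ℝ} (hs : 0 ≤ s) : h (x + s • d) ≤ h x := by
  have h1 := (hh.recFun_nonpos_iff d).1 hd
  have h2 := hh.ne_bot x
  induction hx : h x with
  | bot => exact (h2 hx).elim
  | coe a => simpa [epi] using h1 (x, a) hx.le s hs
  | top => exact le_top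

/-- If `h` is bounded above on one half-line, its direction is a recession direction. -/
theorem IsGamma.recFun_nonpos_of_ray (hh : IsGamma h) {x₀ d : X} {c : ℝ}
    (hray : ∀ s : ℝ, 0 ≤ s → h (x₀ + s • d) ≤ c) : recFun h d ≤ 0 := by
  rw [hh.recFun_nonpos_iff]
  rintro ⟨x, r⟩ hx s hs
  -- Mixing `(x, r)` with a far point of the ray, at parameter `s / e` and weight `e`, gives `(x + s
  -- • d, r)` in the limit `e → 0`.
  have key : ∀ e : ℝ, 0 < e → e < 1 →
      (1 - e) • (x, r) + e • (x₀ + (s / e) • d, c) ∈ epi h := fun e he he1 =>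
    hh.convex hx (hray (s / e) (by positivity)) (by linarith) he.le (by ring)
  have hcont : Continuous fun e : ℝ => ((1 - e) • x + e • x₀ + s • d, (1 - e) * r + e * c) := by
    fun_prop
  have hlim : Filter.Tendsto
      (fun e : ℝ => ((1 - e) • x + e • x₀ + s • d, (1 - e) * r + e * c))
      (nhdsWithin 0 (Set.Ioi 0)) (nhds ((x, r) + s • (d, (0 : ℝ)))) := by
    have := hcont.tendsto 0
    simp only [sub_zero, one_smul, zero_smul, add_zero, one_mul, zero_mul] at this
    simpa using this.mono_left nhdsWithin_le_nhds
  refine hh.isClosed.mem_of_tendsto hlim ?_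
  filter_upwards [Ioo_mem_nhdsGT (zero_lt_one (α := ℝ))] with e he
  have := key e he.1 he.2
  convert this using 1
  ext
  · simp [smul_smul, mul_div_cancel₀ _ he.1.ne', add_assoc]
  · simp

/-- Compactness modulo the common recession space, in the weak topology, of a finite subsystem of
convex inequalities. -/
theorem exists_isCompact_weak_slice [LocallyConvexSpace ℝ X] {ι : Type*} (g : ι → X → EReal)
    (hg : ∀ i, IsGamma (g i)) (c : ι → ℝ) (x₀ : X) (hx₀ : ∀ i, g i x₀ ≤ c i)
    (L : Submodule ℝ X) (hL : ∀ d, (∀ i, recFun (g i) d ≤ 0) → d ∈ L)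
    (F : Finset ι) (C : Set X) (hC : LocallyCompactSpace (toWeakSpace ℝ X '' C))
    (hFC : ∀ x, (∀ i ∈ F, g i x ≤ c i) → x ∈ C) :
    ∃ (H : Finset ι) (A : Set X), (∀ x, ∃ l ∈ L, x + l ∈ A) ∧
      IsCompact {y : WeakSpace ℝ X | (∀ i ∈ H, g i ((toWeakSpace ℝ X).symm y) ≤ c i) ∧
        (toWeakSpace ℝ X).symm y ∈ A} := by
  set k := toWeakSpace ℝ X with hk
  have hx₀C : k x₀ ∈ k '' C := Set.mem_image_of_mem _ (hFC x₀ fun i _ => hx₀ i)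
  obtain ⟨N, hN, hNx⟩ := exists_compact_mem_nhds (⟨k x₀, hx₀C⟩ : k '' C)
  obtain ⟨U, hU, hUN⟩ := mem_nhds_subtype _ _ _ |>.1 hNx
  obtain ⟨s, φ, hφ⟩ := WeakSpace.exists_slab_subset (k x₀) U hU
  obtain ⟨H, M, hM, hcomp⟩ := exists_isCompact_inter_slice
    (fun i => {y : WeakSpace ℝ X | g i (k.symm y) ≤ c i})
    (fun i => (hg i).isClosed_weak_sublevel (c i))
    (fun i => ((hg i).convex_sublevel (c i)).linear_preimage k.symm.toLinearMap)
    (k x₀) (fun i => by simpa using hx₀ i) (L.comap k.symm.toLinearMap)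
    (fun d hd => hL (k.symm d) fun i => (hg i).recFun_nonpos_of_ray (x₀ := x₀) fun s hs => by
      simpa using hd i s hs)
    F (Subtype.val '' N) (hN.image continuous_subtype_val) φ (fun y hy hy1 => by
      have hyC : y ∈ k '' C := ⟨k.symm y, hFC _ hy, by simp⟩
      exact ⟨⟨y, hyC⟩, hUN (hφ y hy1), rfl⟩)
  refine ⟨H, {x | k x - k x₀ ∈ M}, fun x => ?_, by simpa using hcomp⟩
  obtain ⟨l, hl, hlM⟩ := hM (k x)
  exact ⟨k.symm l, hl, by simpa using hlM⟩

end Gamma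

/-! ### Extended-real sums and the Lagrangian -/

theorem EReal.coe_finsetSum {κ : Type*} (s : Finset κ) (b : κ → ℝ) :
    ((∑ t ∈ s, b t : ℝ) : EReal) = ∑ t ∈ s, (b t : EReal) :=
  map_sum (⟨⟨Real.toEReal, EReal.coe_zero⟩, EReal.coe_add⟩ : ℝ →+ EReal) b s

theorem EReal.sum_ne_bot {κ : Type*} (s : Finset κ) (b : κ → EReal) (hb : ∀ t ∈ s, b t ≠ ⊥) :
    ∑ t ∈ s, b t ≠ ⊥ := by
  classical
  induction s using Finset.induction_on with
  | empty => simp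
  | insert t s ht ih =>
    rw [Finset.sum_insert ht]
    exact EReal.add_ne_bot_iff.2 ⟨hb t (Finset.mem_insert_self _ _),
      ih fun u hu => hb u (Finset.mem_insert_of_mem hu)⟩

/-- A lower bound for a positive combination of extended reals need only be checked when all terms
are real. -/
theorem EReal.le_add_sum_mul {κ : Type*} [Fintype κ] {a : EReal} {b : κ → EReal} {m : κ → ℝ}
    {α : ℝ} (ha : a ≠ ⊥) (hb : ∀ t, b t ≠ ⊥) (hm : ∀ t, 0 < m t)
    (h : ∀ (p : ℝ) (q : κ → ℝ), a = p → (∀ t, b t = q t) → α ≤ p + ∑ t, m t * q t) :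
    (α : EReal) ≤ a + ∑ t, (m t : EReal) * b t := by
  classical
  have hbt : ∀ t, (m t : EReal) * b t ≠ ⊥ := fun t => by
    have := hb t
    induction hbt : b t with
    | bot => exact (this hbt).elim
    | coe r => rw [← EReal.coe_mul]; exact EReal.coe_ne_bot _
    | top => rw [EReal.coe_mul_top_of_pos (hm t)]; exact top_ne_bot
  by_cases hfin : a ≠ ⊤ ∧ ∀ t, b t ≠ ⊤
  · have hq : ∀ t, b t = ((b t).toReal : EReal) := fun t =>
      (EReal.coe_toReal (hfin.2 t) (hb t)).symm
    have hp : a = (a.toReal : EReal) := (EReal.coe_toReal hfin.1 ha).symm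
    have h1 := h _ _ hp hq
    have h2 : ∑ t, (m t : EReal) * b t = ((∑ t, m t * (b t).toReal : ℝ) : EReal) := by
      rw [EReal.coe_finsetSum]
      exact Finset.sum_congr rfl fun t _ => by rw [EReal.coe_mul, ← hq t]
    rw [h2, hp]
    exact_mod_cast h1
  · rw [not_and_or, not_not, not_forall] at hfin
    suffices a + ∑ t, (m t : EReal) * b t = ⊤ by rw [this]; exact le_top
    rcases hfin with rfl | ⟨t, ht⟩
    · exact EReal.top_add_of_ne_bot (EReal.sum_ne_bot _ _ fun t _ => hbt t)
    · rw [not_not] at ht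
      rw [← Finset.add_sum_erase _ _ (Finset.mem_univ t), ht, EReal.coe_mul_top_of_pos (hm t),
        EReal.top_add_of_ne_bot (EReal.sum_ne_bot _ _ fun t _ => hbt t),
        EReal.add_top_of_ne_bot ha]

theorem lagrangian_le {X T : Type*} (f : X → EReal) (ft : T → X → EReal) (lam : T →₀ ℝ≥0) (x : X)
    {c : ℝ} {e : T → ℝ} (hf : f x ≤ c) (hft : ∀ t ∈ lam.support, ft t x ≤ e t) :
    lagrangian f ft lam x ≤ ((c + ∑ t ∈ lam.support, lam t * e t : ℝ) : EReal) := by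
  rw [EReal.coe_add, EReal.coe_finsetSum]
  refine add_le_add hf (Finset.sum_le_sum fun t ht => ?_)
  rw [EReal.coe_mul]
  exact mul_le_mul_of_nonneg_left (hft t ht) (by exact_mod_cast (lam t).2)

/-! ### Attainment and approximate multipliers -/

section Problem

variable {X : Type*} [AddCommGroup X] [Module ℝ X] [TopologicalSpace X]
  [IsTopologicalAddGroup X] [ContinuousSMul ℝ X] [LocallyConvexSpace ℝ X]
  {T : Type*} {f : X → EReal} {ft : T → X → EReal}

/-- On `f ≤ c`, `f_t ≤ 1` over the support of `lam`, the Lagrangian is at most `c + ∑ lam t`, so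
these points lie in a locally compact sublevel set. The level 1 leaves room for the later relaxation
of the constraints. -/
theorem exists_isCompact_subsystem (hf : IsGamma f) (hft : ∀ t, IsGamma (ft t))
    {x₀ : X} (hx₀ : x₀ ∈ feasibleSet ft) {lam : T →₀ ℝ≥0}
    (hcomp : WeaklyInfLocallyCompact (lagrangian f ft lam)) {L : Submodule ℝ X}
    (hL : (L : Set X) = problemRecCone f ft) {c : ℝ} (hc : f x₀ ≤ c) :
    ∃ (K : Finset T) (A : Set X), (∀ x, ∃ l ∈ L, x + l ∈ A) ∧
      IsCompact {y : WeakSpace ℝ X | (f ((toWeakSpace ℝ X).symm y) ≤ c ∧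
        ∀ t ∈ K, ft t ((toWeakSpace ℝ X).symm y) ≤ (1 : ℝ)) ∧ (toWeakSpace ℝ X).symm y ∈ A} := by
  obtain ⟨H, A, hA, hH⟩ := exists_isCompact_weak_slice (fun o : Option T => o.elim f ft)
    (by rintro (_ | t); exacts [hf, hft t]) (fun o => o.elim c fun _ => 1) x₀
    (by
      rintro (_ | t)
      · exact hc
      · exact (hx₀ t).trans (by simp))
    L (fun d hd => by
      rw [← SetLike.mem_coe, hL]
      exact ⟨Set.mem_iInter.2 fun t => hd (some t), hd none⟩)
    (Finset.insertNone lam.support) _ (hcomp (c + ∑ t ∈ lam.support, (lam t : ℝ) * 1))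
    (fun x hx => lagrangian_le f ft lam x (e := fun _ => 1) (hx none (by simp)) fun t ht =>
      hx (some t) (Finset.some_mem_insertNone.2 ht))
  refine ⟨Finset.eraseNone H, A, hA, ?_⟩
  -- The finite set `H` need not contain the index of `f`; intersecting with `f ≤ c` restores that
  -- inequality.
  convert hH.inter_right (hf.isClosed_weak_sublevel c) using 1
  ext y
  simp only [Set.mem_ofPred_eq, Set.mem_inter_iff, Option.forall, Option.elim,
    Finset.mem_eraseNone]
  tauto

/-- A number strictly below the optimal value is nearly attained by a Lagrange multiplier, as soon as
a finite subsystem is weakly compact modulo directions of weak decrease. -/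
theorem exists_le_lagrangian [Nonempty T] (hf : IsGamma f) (hft : ∀ t, IsGamma (ft t))
    {x₀ : X} (hx₀ : x₀ ∈ feasibleSet ft) {L : Set X}
    (hLf : ∀ l ∈ L, ∀ x, f (x + l) ≤ f x) (hLft : ∀ l ∈ L, ∀ t x, ft t (x + l) ≤ ft t x)
    {c : ℝ} (hc : f x₀ < c) {K : Finset T} {A : Set X} (hA : ∀ x, ∃ l ∈ L, x + l ∈ A)
    (hQ : IsCompact {y : WeakSpace ℝ X | (f ((toWeakSpace ℝ X).symm y) ≤ c ∧
        ∀ t ∈ K, ft t ((toWeakSpace ℝ X).symm y) ≤ (1 : ℝ)) ∧ (toWeakSpace ℝ X).symm y ∈ A})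
    {α α' : ℝ} (hαc : α ≤ c) (hα' : α' < α) (hα : ∀ x ∈ feasibleSet ft, ¬ f x ≤ α) :
    ∃ lam : T →₀ ℝ≥0, lam.support.Nonempty ∧ ∀ x, (α' : EReal) ≤ lagrangian f ft lam x := by
  classical
  set k := toWeakSpace ℝ X with hk
  set Q := {y : WeakSpace ℝ X | (f (k.symm y) ≤ c ∧ ∀ t ∈ K, ft t (k.symm y) ≤ (1 : ℝ)) ∧
    k.symm y ∈ A} with hQdef
  have hn0 : ∀ n : ℕ, (0 : ℝ) < 1 / (n + 1) := fun n => by positivity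
  let Z : Finset T × ℕ → Set (WeakSpace ℝ X) := fun p =>
    {y | f (k.symm y) ≤ α ∧ ∀ t ∈ p.1, ft t (k.symm y) ≤ ((1 / (p.2 + 1) : ℝ) : EReal)}
  have hZcl : ∀ p, IsClosed (Z p) := fun p => by
    simp only [Z, Set.ofPred_and, Set.ofPred_forall]
    exact (hf.isClosed_weak_sublevel α).inter
      (isClosed_biInter fun t _ => (hft t).isClosed_weak_sublevel _)
  have hempty : Q ∩ ⋂ p, Z p = ∅ := by
    rw [Set.eq_empty_iff_forall_notMem]
    rintro y ⟨-, hy⟩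
    rw [Set.mem_iInter] at hy
    refine hα (k.symm y) (fun t => ?_) (hy (∅, 0)).1
    refine ge_of_tendsto' (EReal.tendsto_coe.2 tendsto_one_div_add_atTop_nhds_zero_nat) fun n => ?_
    exact (hy ({t}, n)).2 t (Finset.mem_singleton_self t)
  have hdir : Directed (· ⊇ ·) Z := by
    have hmono : ∀ p q, p ≤ q → Z q ⊆ Z p := fun p q hpq y hy => by
      refine ⟨hy.1, fun t ht => (hy.2 t (hpq.1 ht)).trans ?_⟩
      have : (1 / (q.2 + 1) : ℝ) ≤ 1 / (p.2 + 1) := by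
        have := hpq.2
        gcongr
      exact_mod_cast this
    exact fun p q => ⟨p ⊔ q, hmono _ _ le_sup_left, hmono _ _ le_sup_right⟩
  obtain ⟨⟨K', n⟩, hKn⟩ := hQ.elim_directed_family_closed Z hZcl hempty hdir
  -- `t₀` ensures a nonempty support, as the Haar dual requires.
  obtain ⟨t₀⟩ := ‹Nonempty T›
  set J := insert t₀ (K ∪ K') with hJ
  have hKJ : ∀ t ∈ K, t ∈ J := fun t ht => by simp [hJ, ht]
  have hKJ' : ∀ t ∈ K', t ∈ J := fun t ht => by simp [hJ, ht]
  have hn1 : (1 / (n + 1) : ℝ) ≤ 1 := by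
    rw [div_le_one (by positivity)]; linarith [n.cast_nonneg (α := ℝ)]
  let g : Option J → X → EReal := fun o => o.elim f fun t => ft t
  have hg : ∀ o, IsGamma (g o) := by rintro (_ | t); exacts [hf, hft t]
  have hgL : ∀ l ∈ L, ∀ o x, g o (x + l) ≤ g o x := by
    rintro l hl (_ | t) x; exacts [hLf l hl x, hLft l hl t x]
  have hpt : ∀ t, ft t x₀ ≤ 0 := hx₀
  have hslice : ∀ x, (∀ o, g o x ≤ ((o.elim c fun _ => 1 : ℝ) : EReal)) → ∃ l ∈ L,
      k (x + l) ∈ Q := fun x hx => by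
    obtain ⟨l, hl, hlA⟩ := hA x
    exact ⟨l, hl, ⟨(hLf l hl x).trans (hx none), fun t ht => (hLft l hl t x).trans
      (hx (some ⟨t, hKJ t ht⟩))⟩, hlA⟩
  have hb : ∀ o, g o x₀ < ((o.elim c fun _ => 1 : ℝ) : EReal) := by
    rintro (_ | t)
    · exact hc
    · exact (hpt t).trans_lt (by simp)
  obtain ⟨m, hm0, hm1, hm⟩ := exists_pos_multipliers g (fun o => (hg o).convex)
    (fun o => o.elim c fun _ => 1) (fun o => o.elim α fun _ => 1 / (n + 1)) none x₀
    (by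
      rintro (_ | t) ht
      · exact (ht rfl).elim
      · exact (hpt t).trans_lt (by exact_mod_cast hn0 n))
    hb
    (fun x hx => by
      obtain ⟨l, hl, hlQ⟩ := hslice x (by
        rintro (_ | t)
        · exact (hx none).trans (by exact_mod_cast hαc)
        · exact (hx (some t)).trans (by exact_mod_cast hn1))
      have : k (x + l) ∈ Q ∩ Z (K', n) := ⟨hlQ, (hLf l hl x).trans (hx none), fun t ht =>
        (hLft l hl t x).trans (hx (some ⟨t, hKJ' t ht⟩))⟩
      rw [hKn] at this
      exact this)
    -- Weierstrass on `Q` bounds each function below there; translation along `L` extends the bound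
    -- to the whole level set.
    (fun o => by
      obtain ⟨l₀, hl₀, hl₀Q⟩ := hslice x₀ fun o => (hb o).le
      obtain ⟨y, -, hy⟩ := ((hg o).lowerSemicontinuous_weak.lowerSemicontinuousOn Q).exists_isMinOn
        ⟨_, hl₀Q⟩ hQ
      obtain ⟨N, -, hN⟩ := EReal.lt_iff_exists_real_btwn.1
        (bot_lt_iff_ne_bot.2 ((hg o).ne_bot (k.symm y)))
      refine ⟨N, fun x hx => ?_⟩
      obtain ⟨l, hl, hlQ⟩ := hslice x hx
      exact hN.trans_le ((isMinOn_iff.1 hy _ hlQ).trans (hgL l hl o x)))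
    (by
      rintro (_ | t) ht
      · exact (ht rfl).elim
      · exact (hn0 n).le)
    α' hα'
  let lam : T →₀ ℝ≥0 := Finsupp.onFinset J
    (fun t => if h : t ∈ J then (m (some ⟨t, h⟩)).toNNReal else 0)
    (fun t ht => by by_contra h; simp [h] at ht)
  have hlam : ∀ t : J, (lam t : ℝ) = m (some t) := fun t => by
    simp [lam, (hm0 (some t)).le]
  have hsupp : lam.support = J := by
    ext t
    rw [Finsupp.mem_support_iff]
    refine ⟨fun h => by_contra fun h' => h (by simp [lam, h']), fun h h0 => ?_⟩
    have := hlam ⟨t, h⟩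
    rw [h0] at this
    exact (hm0 (some ⟨t, h⟩)).ne this
  refine ⟨lam, ⟨t₀, by simp [hsupp, hJ]⟩, fun x => ?_⟩
  rw [lagrangian, hsupp, ← Finset.sum_coe_sort J]
  refine EReal.le_add_sum_mul (hf.ne_bot x) (fun t => (hft t).ne_bot x)
    (fun t => by rw [hlam]; exact hm0 _) fun p q hp hq => ?_
  have := hm x (fun o => o.elim p q) (by
    rintro (_ | t)
    exacts [hp.le, (hq t).le])
  rw [Fintype.sum_option, hm1] at this
  simpa [hlam] using this

/-- A minimizer over the compact feasible slice is global: feasible points with `f ≤ c` translate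
into the slice without increasing `f`, and the others have values at least `c`. -/
theorem exists_isMinOn_feasibleSet (hf : IsGamma f) (hft : ∀ t, IsGamma (ft t))
    {x₀ : X} (hx₀ : x₀ ∈ feasibleSet ft) {L : Set X}
    (hLf : ∀ l ∈ L, ∀ x, f (x + l) ≤ f x) (hLft : ∀ l ∈ L, ∀ t x, ft t (x + l) ≤ ft t x)
    {c : ℝ} (hc : f x₀ ≤ c) {K : Finset T} {A : Set X} (hA : ∀ x, ∃ l ∈ L, x + l ∈ A)
    (hQ : IsCompact {y : WeakSpace ℝ X | (f ((toWeakSpace ℝ X).symm y) ≤ c ∧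
        ∀ t ∈ K, ft t ((toWeakSpace ℝ X).symm y) ≤ (1 : ℝ)) ∧ (toWeakSpace ℝ X).symm y ∈ A}) :
    ∃ z ∈ feasibleSet ft, IsMinOn f (feasibleSet ft) z := by
  set k := toWeakSpace ℝ X with hk
  set Q := {y : WeakSpace ℝ X | (f (k.symm y) ≤ c ∧ ∀ t ∈ K, ft t (k.symm y) ≤ (1 : ℝ)) ∧
    k.symm y ∈ A} with hQdef
  have hEcl : IsClosed {y : WeakSpace ℝ X | ∀ t, ft t (k.symm y) ≤ ((0 : ℝ) : EReal)} := by
    simp only [Set.ofPred_forall]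
    exact isClosed_iInter fun t => (hft t).isClosed_weak_sublevel 0
  have hmem : ∀ x ∈ feasibleSet ft, f x ≤ c → ∃ l ∈ L,
      k (x + l) ∈ Q ∩ {y : WeakSpace ℝ X | ∀ t, ft t (k.symm y) ≤ ((0 : ℝ) : EReal)} := by
    intro x hx hxc
    obtain ⟨l, hl, hlA⟩ := hA x
    have h0 : ∀ t, ft t (x + l) ≤ 0 := fun t => (hLft l hl t x).trans (hx t)
    exact ⟨l, hl, ⟨⟨(hLf l hl x).trans hxc, fun t _ => (h0 t).trans (by simp)⟩, hlA⟩, h0⟩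
  obtain ⟨l₀, -, hl₀⟩ := hmem x₀ hx₀ hc
  obtain ⟨y, hy, hmin⟩ := (hf.lowerSemicontinuous_weak.lowerSemicontinuousOn _).exists_isMinOn
    ⟨_, hl₀⟩ (hQ.inter_right hEcl)
  refine ⟨k.symm y, hy.2, isMinOn_iff.2 fun x hx => ?_⟩
  rcases le_total (f x) c with hxc | hxc
  · obtain ⟨l, hl, hlQ⟩ := hmem x hx hxc
    exact (isMinOn_iff.1 hmin _ hlQ).trans (hLf l hl x)
  · exact hy.1.1.1.trans hxc

theorem lagrangian_le_of_mem_feasibleSet {X T : Type*} (f : X → EReal) (ft : T → X → EReal)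
    (lam : T →₀ ℝ≥0) {x : X} (hx : x ∈ feasibleSet ft) {c : ℝ} (hf : f x ≤ c) :
    lagrangian f ft lam x ≤ c := by
  simpa using lagrangian_le f ft lam x (e := 0) hf fun t _ => by simpa using hx t

end Problem

/-! ### Zero duality gap -/

theorem corollary6 {X : Type*} [AddCommGroup X] [Module ℝ X] [TopologicalSpace X]
    [IsTopologicalAddGroup X] [ContinuousSMul ℝ X] [LocallyConvexSpace ℝ X] [T2Space X]
    {T : Type*} [Nonempty T] (f : X → EReal) (ft : T → X → EReal)
    (hf : IsGamma f) (hft : ∀ t, IsGamma (ft t))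
    (hE : (feasibleSet ft ∩ effDom f).Nonempty)
    (hcomp : ∃ lam : T →₀ ℝ≥0, WeaklyInfLocallyCompact (lagrangian f ft lam))
    (hrec : ∃ L : Submodule ℝ X, (L : Set X) = problemRecCone f ft) :
    ∃ r : ℝ, IsLeast (f '' feasibleSet ft) (r : EReal) ∧
      supLagrangeHaarDual f ft = (r : EReal) ∧
      supLagrangeDual f ft = (r : EReal) := by
  obtain ⟨x₀, hx₀, hx₀f⟩ := hE
  obtain ⟨lam₀, hlam₀⟩ := hcomp
  obtain ⟨L, hL⟩ := hrec
  have hmemL : ∀ l ∈ (L : Set X), (∀ t, recFun (ft t) l ≤ 0) ∧ recFun f l ≤ 0 := fun l hl => by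
    rw [hL] at hl
    exact ⟨(Set.mem_iInter (s := fun t => {x | recFun (ft t) x ≤ 0})).1 hl.1, hl.2⟩
  have hLf : ∀ l ∈ (L : Set X), ∀ x, f (x + l) ≤ f x := fun l hl x => by
    simpa using hf.le_of_recFun_nonpos (hmemL l hl).2 x zero_le_one
  have hLft : ∀ l ∈ (L : Set X), ∀ t x, ft t (x + l) ≤ ft t x := fun l hl t x => by
    simpa using (hft t).le_of_recFun_nonpos ((hmemL l hl).1 t) x zero_le_one
  obtain ⟨c, hc, -⟩ := EReal.lt_iff_exists_real_btwn.1 (show f x₀ < ⊤ from hx₀f)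
  obtain ⟨K, A, hA, hQ⟩ := exists_isCompact_subsystem hf hft hx₀ hlam₀ hL hc.le
  obtain ⟨z, hz, hmin⟩ := exists_isMinOn_feasibleSet hf hft hx₀ hLf hLft hc.le hA hQ
  rw [isMinOn_iff] at hmin
  have hzc : f z < c := (hmin x₀ hx₀).trans_lt hc
  have hv : f z = ((f z).toReal : EReal) :=
    (EReal.coe_toReal (hzc.trans (EReal.coe_lt_top c)).ne (hf.ne_bot z)).symm
  set v := (f z).toReal
  have hlow : ∀ a : ℝ, a < v → ∃ lam : T →₀ ℝ≥0, lam.support.Nonempty ∧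
      ∀ x, (a : EReal) ≤ lagrangian f ft lam x := fun a ha => by
    obtain ⟨b, hab, hbv⟩ := exists_between ha
    refine exists_le_lagrangian hf hft hx₀ hLf hLft hc hA hQ ?_ hab fun x hx hxb => ?_
    · rw [hv] at hzc
      exact hbv.le.trans (by exact_mod_cast hzc.le)
    · have h1 := (hmin x hx).trans hxb
      rw [hv] at h1
      exact hbv.not_ge (by exact_mod_cast h1)
  have hHaar : supLagrangeHaarDual f ft ≤ v := by
    refine iSup_le fun H => iSup_le fun _ => iSup_le fun m => (iInf_le _ z).trans ?_
    rw [← hv, ← add_zero (f z), add_assoc, zero_add]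
    refine add_le_add le_rfl (Finset.sum_nonpos fun t _ => ?_)
    rw [← mul_zero ((m t : ℝ) : EReal)]
    exact mul_le_mul_of_nonneg_left (hz t) (by exact_mod_cast (m t).2)
  refine ⟨v, ⟨⟨z, hz, hv⟩, ?_⟩, hHaar.antisymm ?_, le_antisymm ?_ ?_⟩
  · rintro _ ⟨x, hx, rfl⟩
    rw [← hv]
    exact hmin x hx
  · refine EReal.ge_of_forall_gt_iff_ge.1 fun a ha => ?_
    obtain ⟨lam, hne, hlam⟩ := hlow a (by exact_mod_cast ha)
    refine le_iSup₂_of_le lam.support hne (le_iSup_of_le (fun t => lam t) (le_iInf fun x => ?_))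
    refine (hlam x).trans_eq ?_
    rw [lagrangian, ← Finset.sum_coe_sort lam.support]
  · exact iSup_le fun lam => (iInf_le _ z).trans
      (lagrangian_le_of_mem_feasibleSet f ft lam hz hv.le)
  · refine EReal.ge_of_forall_gt_iff_ge.1 fun a ha => ?_
    obtain ⟨lam, -, hlam⟩ := hlow a (by exact_mod_cast ha)
    exact le_iSup_of_le lam (le_iInf hlam)
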